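/- Let $\mathscr X=[0,1]$ with its Borel $\sigma$-algebra. A stationary ergodic process is a shift-invariant, ergodic probability measure $\mu$ on $\mathscr X^{\mathbb N}$ (with the product $\sigma$-algebra), with coordinate variables ${\bf X}=\langle X_t\rangle_{t\ge 1}$; $\mathscr E$ is the set of these processes, and $\mathscr I$ is the set of i.i.d. processes, that is, those under which $X_1,X_2,\dots$ are independent and identically distributed. For $\mu\in\mathscr E$ and $m\ge 1$ let $$\alpha(m)=\sup_{j\ge 1}\ \sup\bigl\{|\mu(U\cap V)-\mu(U)\mu(V)| : U\in\sigma(X_1,\dots,X_j),\ V\in\sigma(X_t: t\ge j+m)\bigr\},$$ and let $\|\boldsymbol\alpha\|=\sum_{m\ge 1}\alpha(m)\in[0,\infty]$. There exists a strongly consistent test for independence on $\mathscr E$, which is at the same time a strongly consistent test of the hypothesis $\|\boldsymbol\alpha\|\le 0$: there is a sequence of functions $f_t:\mathscr X^{\mathbb N}\to\{+1,-1\}$, not depending on $\mu$, with $f_t$ measurable with respect to $\sigma(X_1,\dots,X_t)$ for each $t$, such that for every $\mu\in\mathscr E$, with $\mu$-probability one, $$\lim_{t\to\infty} f_t({\bf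 X})=\begin{cases}+1&\text{if }\mu\in\mathscr E\cap\mathscr I,\\-1&\text{if }\mu\in\mathscr E\setminus\mathscr I,\end{cases} \qquad\text{and}\qquad \lim_{t\to\infty} f_t({\bf X})=\begin{cases}+1&\text{if }\|\boldsymbol\alpha\|\le 0,\\-1&\text{if }\|\boldsymbol\alpha\|>0.\end{cases}$$ -/

import Mathlib

open MeasureTheory ProbabilityTheory Filter Topology
open scoped ENNReal unitInterval

namespace IndepTest

/-- The space of one-sided sequences with values in `[0,1]`, with the product (cylinder)
`σ`-algebra. The coordinate `x i` is the `(i+1)`-st observation, `X_{i+1}`. -/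
abbrev Path : Type := ℕ → I

/-- The left shift `(a₁, a₂, …) ↦ (a₂, a₃, …)`. -/
def shift (x : Path) : Path := fun i => x (i + 1)

/-- `σ(X_1, …, X_t)`, the information in the first `t` observations. -/
abbrev past (t : ℕ) : MeasurableSpace Path :=
  ⨆ i : {i : ℕ // i < t}, MeasurableSpace.comap (fun x : Path => x i) inferInstance

/-- `σ(X_s : s > t)`, the information in all observations after the first `t`. -/
abbrev future (t : ℕ) : MeasurableSpace Path :=
  ⨆ i : {i : ℕ // t ≤ i}, MeasurableSpace.comap (fun x : Path => x i) inferInstance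

/-- A stationary ergodic process: a shift-invariant probability measure on the path space
for which every measurable `B` with `S⁻¹ B = B` is trivial. -/
def IsStationaryErgodic (μ : Measure Path) : Prop :=
  IsProbabilityMeasure μ ∧ Ergodic shift μ

/-- An i.i.d. process: the coordinates are jointly independent and identically distributed. -/
def IsIID (μ : Measure Path) : Prop :=
  iIndepFun (fun (i : ℕ) (x : Path) => x i) μ ∧
    ∀ i : ℕ, IdentDistrib (fun x : Path => x i) (fun x : Path => x 0) μ μ

/-- The `α`-dependence between two `σ`-algebras,
`sup {|μ(U ∩ V) - μ(U) μ(V)| : U ∈ 𝔘, V ∈ 𝔙}`. -/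
noncomputable def alphaDep (μ : Measure Path) (𝔘 𝔙 : MeasurableSpace Path) : ℝ≥0∞ :=
  ⨆ (U : Set Path) (_ : MeasurableSet[𝔘] U) (V : Set Path) (_ : MeasurableSet[𝔙] V),
    ENNReal.ofReal |μ.real (U ∩ V) - μ.real U * μ.real V|

/-- The `α`-mixing coefficient
`α(m) = sup_{j ≥ 1} α(σ(X_1, …, X_j), σ(X_s : s ≥ j + m))`, for `m ≥ 1`. -/
noncomputable def alphaCoeff (μ : Measure Path) (m : ℕ) : ℝ≥0∞ :=
  ⨆ (j : ℕ) (_ : 1 ≤ j), alphaDep μ (past j) (future (j + m - 1))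

/-- The norm `‖α‖ = ∑_{m ≥ 1} α(m)`, in `[0, ∞]`. -/
noncomputable def alphaNorm (μ : Measure Path) : ℝ≥0∞ :=
  ∑' m : ℕ, alphaCoeff μ (m + 1)

/-- A sequential test: at each time `t` a decision `+1` or `-1` that is a measurable
function of the first `t` observations. -/
def IsSequentialTest (f : ℕ → Path → ℤ) : Prop :=
  ∀ t : ℕ, Measurable[past t] (f t) ∧ ∀ x : Path, f t x = 1 ∨ f t x = -1

/-- On the class of stationary ergodic processes, the test `f` is strongly consistent for the
null hypothesis `H₀`: its decisions converge almost surely to `+1` if `H₀` holds and to `-1`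
if it does not. -/
def IsStronglyConsistent (f : ℕ → Path → ℤ) (H₀ : Measure Path → Prop) : Prop :=
  ∀ μ : Measure Path, IsStationaryErgodic μ →
    (H₀ μ → ∀ᵐ x ∂μ, Tendsto (fun t => f t x) atTop (𝓝 1)) ∧
    (¬ H₀ μ → ∀ᵐ x ∂μ, Tendsto (fun t => f t x) atTop (𝓝 (-1)))

end IndepTest

/-! For a stationary measure, being i.i.d. amounts to countably many identities `μ.real (cyl (q ::
l)) = μ.real (cyl [q]) * μ.real (cyl l)` with rational thresholds (`isIID_of_measureReal_cyl_cons`).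
The test compares empirical frequencies in more and more of these identities, with a tolerance that
tends to 0.

If the process is not i.i.d., some identity fails. By Birkhoff's theorem (`ae_tendsto_freq`) its
empirical discrepancy tends to a positive limit, which eventually exceeds the tolerance. If the
process is i.i.d., a rate is needed: occurrences of a cylinder at distant times are uncorrelated, so
frequencies over `n` shifts have variance `O(1 / n)` (`variance_freq_le`). With `n = 2 ^ m` at stage
`m`, Chebyshev's inequality and a union bound make false rejections summable, and Borel–Cantelli
applies.

The same test serves `‖α‖ ≤ 0`, since on stationary ergodic processes this is the i.i.d. hypothesis
(`alphaNorm_nonpos_iff_isIID`). -/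

namespace ErgodicTheorem

/-! ### The pointwise ergodic theorem, from the maximal lemma. -/

variable {α : Type*}

/-- The maximum of the Birkhoff sums of `g` over at most `n` steps. -/
noncomputable def maxSum (T : α → α) (g : α → ℝ) : ℕ → α → ℝ
  | 0, _ => 0
  | n + 1, x => max 0 (g x + maxSum T g n (T x))

lemma maxSum_nonneg (T : α → α) (g : α → ℝ) (n : ℕ) (x : α) : 0 ≤ maxSum T g n x := by
  cases n with
  | zero => exact le_rfl
  | succ n => exact le_max_left _ _

lemma maxSum_le_succ (T : α → α) (g : α → ℝ) (n : ℕ) (x : α) :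
    maxSum T g n x ≤ maxSum T g (n + 1) x := by
  induction n generalizing x with
  | zero => exact maxSum_nonneg T g 1 x
  | succ n ih => exact max_le_max le_rfl (add_le_add le_rfl (ih (T x)))

lemma birkhoffSum_le_maxSum (T : α → α) (g : α → ℝ) (n : ℕ) (x : α) :
    birkhoffSum T g n x ≤ maxSum T g n x := by
  induction n generalizing x with
  | zero => simp [maxSum]
  | succ n ih =>
    rw [birkhoffSum_succ']
    exact le_max_of_le_right (add_le_add le_rfl (ih (T x)))

/-- Where the maximum is positive, it is attained by a nonempty sum, which starts with `g x`;
elsewhere it is 0. Under an invariant measure the left side has integral 0, which yields the maximal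
lemma. -/
lemma maxSum_sub_comp_le_indicator (T : α → α) (g : α → ℝ) (n : ℕ) (x : α) :
    maxSum T g (n + 1) x - maxSum T g (n + 1) (T x) ≤
      {y | 0 < maxSum T g (n + 1) y}.indicator g x := by
  by_cases hx : 0 < maxSum T g (n + 1) x
  · rw [Set.indicator_of_mem (by exact hx)]
    have h1 : maxSum T g (n + 1) x = g x + maxSum T g n (T x) := by
      rcases max_choice 0 (g x + maxSum T g n (T x)) with h | h
      · exact absurd (show maxSum T g (n + 1) x = 0 from h) hx.ne'
      · exact h
    linarith [maxSum_le_succ T g n (T x)]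
  · rw [Set.indicator_of_notMem (by exact hx)]
    linarith [maxSum_nonneg T g (n + 1) (T x)]

variable [MeasurableSpace α] {μ : Measure α} {T : α → α} {g : α → ℝ}

lemma measurable_maxSum (hT : Measurable T) (hg : Measurable g) (n : ℕ) :
    Measurable (maxSum T g n) := by
  induction n with
  | zero => exact measurable_const
  | succ n ih => exact measurable_const.max (hg.add (ih.comp hT))

lemma integrable_maxSum (hT : MeasurePreserving T μ μ) (hg : Integrable g μ) (n : ℕ) :
    Integrable (maxSum T g n) μ := by
  induction n with
  | zero => exact integrable_zero _ _ _
  | succ n ih =>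
    exact (integrable_zero _ _ _).sup (hg.add (hT.integrable_comp_of_integrable ih))

/-- The maximal ergodic lemma, in the form used for the ergodic theorem: if almost every point
has a positive Birkhoff sum, then the integral is nonnegative. -/
theorem integral_nonneg_of_ae_exists_birkhoffSum_pos (hT : MeasurePreserving T μ μ)
    (hgm : Measurable g) (hg : Integrable g μ)
    (h : ∀ᵐ x ∂μ, ∃ n, 0 < birkhoffSum T g n x) : 0 ≤ ∫ x, g x ∂μ := by
  set E : ℕ → Set α := fun n => {y | 0 < maxSum T g (n + 1) y}
  have hE : ∀ n, MeasurableSet (E n) := fun n =>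
    measurableSet_lt measurable_const (measurable_maxSum hT.measurable hgm _)
  have hpos : ∀ n, 0 ≤ ∫ x, (E n).indicator g x ∂μ := by
    intro n
    have hi := integrable_maxSum hT hg (n + 1)
    have hc : Integrable (fun x => maxSum T g (n + 1) (T x)) μ :=
      hT.integrable_comp_of_integrable hi
    have h0 : ∫ x, (maxSum T g (n + 1) x - maxSum T g (n + 1) (T x)) ∂μ = 0 := by
      rw [integral_sub hi hc, sub_eq_zero, ← integral_map (φ := T) hT.measurable.aemeasurable,
        hT.map_eq]
      exact (measurable_maxSum hT.measurable hgm _).aestronglyMeasurable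
    rw [← h0]
    exact integral_mono (hi.sub hc) (hg.indicator (hE n))
      (maxSum_sub_comp_le_indicator T g n)
  have hlim : Tendsto (fun n => ∫ x, (E n).indicator g x ∂μ) atTop (𝓝 (∫ x, g x ∂μ)) := by
    refine tendsto_integral_of_dominated_convergence (fun x => ‖g x‖)
      (fun n => (hg.indicator (hE n)).aestronglyMeasurable) hg.norm
      (fun n => Eventually.of_forall fun x => norm_indicator_le_norm_self _ _) ?_
    filter_upwards [h] with x ⟨N, hN⟩
    refine tendsto_const_nhds.congr' ?_
    filter_upwards [eventually_ge_atTop N] with n hn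
    have hx : x ∈ E n := (hN.trans_le (birkhoffSum_le_maxSum T g N x)).trans_le
      (monotone_nat_of_le_succ (fun k => maxSum_le_succ T g k x) (by omega))
    rw [Set.indicator_of_mem hx]
  exact ge_of_tendsto' hlim hpos

lemma measurable_birkhoffSum (hT : Measurable T) (hg : Measurable g) (n : ℕ) :
    Measurable (birkhoffSum T g n) :=
  Finset.measurable_fun_sum _ fun k _ => hg.comp (hT.iterate k)

/-- The set where the sums are unbounded above is invariant, hence null or conull. If it were
conull, the maximal lemma would give a nonnegative integral. -/
theorem ae_bddAbove_birkhoffSum (hT : Ergodic T μ) (hgm : Measurable g) (hg : Integrable g μ)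
    (hneg : ∫ x, g x ∂μ < 0) : ∀ᵐ x ∂μ, ∃ K : ℝ, ∀ n, birkhoffSum T g n x ≤ K := by
  set F : Set α := {x | ∀ K : ℕ, ∃ n, (K : ℝ) < birkhoffSum T g n x}
  have hF : MeasurableSet F := by
    have : F = ⋂ K : ℕ, ⋃ n, {x | (K : ℝ) < birkhoffSum T g n x} := by
      ext x; simp [F]
    rw [this]
    exact .iInter fun K => .iUnion fun n =>
      measurableSet_lt measurable_const (measurable_birkhoffSum hT.measurable hgm n)
  have hinv : T ⁻¹' F = F := by
    ext x
    constructor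
    · intro h K
      obtain ⟨K', hK'⟩ := exists_nat_ge ((K : ℝ) - g x)
      obtain ⟨n, hn⟩ := h K'
      exact ⟨n + 1, by rw [birkhoffSum_succ']; linarith⟩
    · intro h K
      -- The maximum with 0 rules out the empty sum, so that a first term can be split off.
      obtain ⟨K', hK'⟩ := exists_nat_ge (max 0 ((K : ℝ) + g x))
      obtain ⟨n, hn⟩ := h K'
      have h1 := (le_max_left 0 ((K : ℝ) + g x)).trans hK'
      have h2 := (le_max_right 0 ((K : ℝ) + g x)).trans hK'
      cases n with
      | zero => simp only [birkhoffSum_zero] at hn; linarith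
      | succ n => rw [birkhoffSum_succ'] at hn; exact ⟨n, by linarith⟩
  rcases hT.toPreErgodic.ae_mem_or_ae_notMem hF hinv with h | h
  · refine absurd (integral_nonneg_of_ae_exists_birkhoffSum_pos hT.toMeasurePreserving hgm hg ?_)
      hneg.not_ge
    filter_upwards [h] with x hx
    simpa using hx 0
  · filter_upwards [h] with x hx
    simp only [F, Set.mem_ofPred_eq, not_forall, not_exists, not_lt] at hx
    exact ⟨_, hx.choose_spec⟩

/-- The function `g - (c + ε / 2)` has negative integral, so its sums are bounded by some `K`, and
`K / n` is eventually at most `ε / 2`. -/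
theorem ae_eventually_birkhoffAverage_le [IsProbabilityMeasure μ] (hT : Ergodic T μ)
    (hgm : Measurable g) (hg : Integrable g μ) {ε : ℝ} (hε : 0 < ε) :
    ∀ᵐ x ∂μ, ∀ᶠ n in atTop, birkhoffAverage ℝ T g n x ≤ ∫ y, g y ∂μ + ε := by
  set c := ∫ y, g y ∂μ with hc
  have hneg : ∫ x, (g x - (c + ε / 2)) ∂μ < 0 := by
    rw [integral_sub hg (integrable_const _)]
    simp [← hc, hε]
  filter_upwards [ae_bddAbove_birkhoffSum hT (hgm.sub_const _) (hg.sub (integrable_const _)) hneg]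
    with x ⟨K, hK⟩
  obtain ⟨N, hN⟩ := exists_nat_ge (K / (ε / 2))
  filter_upwards [eventually_ge_atTop N, eventually_gt_atTop 0] with n hn hn0
  have hn0' : (0 : ℝ) < n := by exact_mod_cast hn0
  have h1 := hK n
  have h2 : birkhoffSum T (fun x => g x - (c + ε / 2)) n x =
      birkhoffSum T g n x - n * (c + ε / 2) := by
    simp only [birkhoffSum, Finset.sum_sub_distrib, Finset.sum_const, Finset.card_range, nsmul_eq_mul]
  have h3 : K ≤ n * (ε / 2) := by
    rw [← div_le_iff₀ (by positivity)]
    exact hN.trans (by exact_mod_cast hn)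
  rw [birkhoffAverage, smul_eq_mul, inv_mul_le_iff₀ hn0']
  linarith

/-- Birkhoff's pointwise ergodic theorem for an ergodic transformation. -/
theorem ae_tendsto_birkhoffAverage [IsProbabilityMeasure μ] (hT : Ergodic T μ)
    (hgm : Measurable g) (hg : Integrable g μ) :
    ∀ᵐ x ∂μ, Tendsto (fun n => birkhoffAverage ℝ T g n x) atTop (𝓝 (∫ y, g y ∂μ)) := by
  have hε : ∀ k : ℕ, (0 : ℝ) < 1 / ((k : ℝ) + 1) := fun k => Nat.one_div_pos_of_nat
  have hup := ae_all_iff.2 fun k : ℕ => ae_eventually_birkhoffAverage_le hT hgm hg (hε k)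
  have hlo := ae_all_iff.2 fun k : ℕ => ae_eventually_birkhoffAverage_le hT hgm.neg hg.neg (hε k)
  filter_upwards [hup, hlo] with x hx hy
  refine Metric.tendsto_atTop'.2 fun ε hε => ?_
  obtain ⟨k, hk⟩ := exists_nat_one_div_lt hε
  have hev : ∀ᶠ n in atTop, dist (birkhoffAverage ℝ T g n x) (∫ y, g y ∂μ) < ε := by
    filter_upwards [hx k, hy k] with n h1 h2
    rw [birkhoffAverage_neg] at h2
    simp only [Pi.neg_apply, integral_neg] at h2
    rw [Real.dist_eq, abs_lt]
    constructor <;> linarith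
  obtain ⟨N, hN⟩ := eventually_atTop.1 hev
  exact ⟨N, fun n hn => hN n hn.le⟩

end ErgodicTheorem

/-! ### Cylinders, the i.i.d. property and the mixing norm. -/

namespace IndepTest

/-- The `σ`-algebra generated by the coordinates with index in `S`. -/
abbrev coordSigma (S : Set ℕ) : MeasurableSpace Path :=
  ⨆ i ∈ S, MeasurableSpace.comap (fun x : Path => x i) inferInstance

lemma past_eq (t : ℕ) : past t = coordSigma (Set.Iio t) := by
  simp only [past, coordSigma, iSup_subtype, Set.mem_Iio]

lemma future_eq (t : ℕ) : future t = coordSigma (Set.Ici t) := by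
  simp only [future, coordSigma, iSup_subtype, Set.mem_Ici]

lemma coordSigma_mono {S T : Set ℕ} (h : S ⊆ T) : coordSigma S ≤ coordSigma T :=
  biSup_mono fun _ hi => h hi

lemma coordSigma_le (S : Set ℕ) : coordSigma S ≤ (inferInstance : MeasurableSpace Path) :=
  iSup₂_le fun i _ => (measurable_pi_apply i).comap_le

lemma measurableSet_coordSigma {S : Set ℕ} {i : ℕ} (hi : i ∈ S) {A : Set I}
    (hA : MeasurableSet A) : MeasurableSet[coordSigma S] ((fun x : Path => x i) ⁻¹' A) :=
  le_iSup₂ (f := fun i (_ : i ∈ S) =>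
    MeasurableSpace.comap (fun x : Path => x i) inferInstance) i hi _ ⟨A, hA, rfl⟩

/-- The lower part of the unit interval cut off at the rational `q`. -/
def lowerPart (q : ℚ) : Set I := {u | (u : ℝ) ≤ q}

lemma measurableSet_lowerPart (q : ℚ) : MeasurableSet (lowerPart q) :=
  measurableSet_le measurable_subtype_coe measurable_const

/-- The cylinder of the paths whose first coordinates are bounded by the entries of a list. -/
def cyl : List ℚ → Set Path
  | [] => Set.univ
  | q :: l => (fun x : Path => x 0) ⁻¹' lowerPart q ∩ shift ⁻¹' cyl l

lemma cyl_singleton (q : ℚ) : cyl [q] = (fun x : Path => x 0) ⁻¹' lowerPart q := by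
  simp [cyl]

lemma shift_iterate_apply (k : ℕ) (x : Path) (i : ℕ) : shift^[k] x i = x (i + k) := by
  induction k generalizing x with
  | zero => rfl
  | succ k ih => rw [Function.iterate_succ_apply, ih, shift, add_assoc]

lemma measurable_shift : Measurable shift :=
  measurable_pi_lambda _ fun i => measurable_pi_apply (i + 1)

lemma mem_cyl_iff (l : List ℚ) (x : Path) :
    x ∈ cyl l ↔ ∀ i (h : i < l.length), x i ∈ lowerPart l[i] := by
  induction l generalizing x with
  | nil => simp [cyl]
  | cons q l ih =>
    constructor
    · rintro ⟨h0, h⟩ i hi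
      cases i with
      | zero => exact h0
      | succ i => exact (ih _).1 h i (by simpa using hi)
    · intro h
      exact ⟨h 0 (by simp), (ih _).2 fun i hi => h (i + 1) (by simpa using hi)⟩

lemma measurableSet_preimage_cyl (l : List ℚ) (s : ℕ) :
    MeasurableSet[coordSigma (Set.Ico s (s + l.length))] (shift^[s] ⁻¹' cyl l) := by
  induction l generalizing s with
  | nil => simp [cyl]
  | cons q l ih =>
    have h1 : shift^[s] ⁻¹' cyl (q :: l) =
        (fun x : Path => x s) ⁻¹' lowerPart q ∩ shift^[s + 1] ⁻¹' cyl l := by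
      rw [Function.iterate_succ', Set.preimage_comp, cyl, Set.preimage_inter, ← Set.preimage_comp]
      congr 2
      ext x
      simp [shift_iterate_apply]
    rw [h1]
    refine MeasurableSet.inter (measurableSet_coordSigma ?_ (measurableSet_lowerPart q))
      (coordSigma_mono ?_ _ (ih (s + 1)))
    · simp
    · intro i
      simp only [Set.mem_Ico, List.length_cons]
      omega

lemma measurableSet_cyl (l : List ℚ) : MeasurableSet (cyl l) :=
  coordSigma_le _ _ (measurableSet_preimage_cyl l 0)

lemma iIndep_of_isIID {μ : Measure Path} (h : IsIID μ) :
    iIndep (fun i : ℕ => MeasurableSpace.comap (fun x : Path => x i) inferInstance) μ := h.1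

lemma indep_coordSigma {μ : Measure Path} (h : IsIID μ) {S T : Set ℕ} (hST : Disjoint S T) :
    Indep (coordSigma S) (coordSigma T) μ :=
  indep_iSup_of_disjoint (fun i => (measurable_pi_apply i).comap_le) (iIndep_of_isIID h) hST

lemma measureReal_preimage_iterate {μ : Measure Path} (hμ : MeasurePreserving shift μ μ) (k : ℕ)
    {B : Set Path} (hB : MeasurableSet B) : μ.real (shift^[k] ⁻¹' B) = μ.real B := by
  rw [Measure.real, (hμ.iterate k).measure_preimage hB.nullMeasurableSet, Measure.real]

lemma measureReal_cyl_cons_of_indep {μ : Measure Path} (hμ : MeasurePreserving shift μ μ)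
    (h : ∀ U V, MeasurableSet[past 1] U → MeasurableSet[future 1] V →
      μ.real (U ∩ V) = μ.real U * μ.real V) (q : ℚ) (l : List ℚ) :
    μ.real (cyl (q :: l)) = μ.real (cyl [q]) * μ.real (cyl l) := by
  rw [← measureReal_preimage_iterate hμ 1 (measurableSet_cyl l), cyl_singleton, cyl]
  refine h _ _ ?_ ?_
  · rw [past_eq]
    exact measurableSet_coordSigma (by simp) (measurableSet_lowerPart q)
  · rw [future_eq]
    exact coordSigma_mono Set.Ico_subset_Ici_self _ (measurableSet_preimage_cyl l 1)

lemma comap_eval_eq_generateFrom (i : ℕ) :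
    MeasurableSpace.comap (fun x : Path => x i) inferInstance =
      MeasurableSpace.generateFrom
        (Set.range fun q : ℚ => (fun x : Path => x i) ⁻¹' lowerPart q) := by
  have h : (inferInstance : MeasurableSpace I) =
      MeasurableSpace.comap (Subtype.val : I → ℝ) inferInstance := rfl
  have h2 : (inferInstance : MeasurableSpace ℝ) = _ :=
    Real.borelSpace.measurable_eq.trans Real.borel_eq_generateFrom_Iic_rat
  rw [h, h2, MeasurableSpace.comap_generateFrom, MeasurableSpace.comap_generateFrom]
  congr 1
  ext B
  simp only [Set.mem_image, Set.mem_iUnion, Set.mem_singleton_iff, Set.mem_range]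
  constructor
  · rintro ⟨_, ⟨_, ⟨q, rfl⟩, rfl⟩, rfl⟩
    exact ⟨q, rfl⟩
  · rintro ⟨q, rfl⟩
    exact ⟨_, ⟨_, ⟨q, rfl⟩, rfl⟩, rfl⟩

lemma isPiSystem_range_lowerPart (i : ℕ) :
    IsPiSystem (Set.range fun q : ℚ => (fun x : Path => x i) ⁻¹' lowerPart q) := by
  rintro _ ⟨p, rfl⟩ _ ⟨q, rfl⟩ _
  refine ⟨min p q, ?_⟩
  ext x
  simp [lowerPart]

/-- Splitting off one coordinate at a time turns the measure of a cylinder into a product. The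
rational lower parts form a generating π-system, so this is independence; identical distribution is
stationarity. -/
theorem isIID_of_measureReal_cyl_cons {μ : Measure Path} [IsProbabilityMeasure μ]
    (hμ : MeasurePreserving shift μ μ)
    (h : ∀ q l, μ.real (cyl (q :: l)) = μ.real (cyl [q]) * μ.real (cyl l)) : IsIID μ := by
  have hprod : ∀ l, μ.real (cyl l) = (l.map fun q => μ.real (cyl [q])).prod := by
    intro l
    induction l with
    | nil => simp [cyl]
    | cons q l ih => rw [h, ih, List.map_cons, List.prod_cons]
  have hcoord : ∀ i q, μ.real ((fun x : Path => x i) ⁻¹' lowerPart q) = μ.real (cyl [q]) := by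
    intro i q
    rw [← measureReal_preimage_iterate hμ i (measurableSet_cyl [q]), cyl_singleton]
    congr 1
    ext x
    simp [shift_iterate_apply]
  refine ⟨?_, fun i => ⟨(measurable_pi_apply i).aemeasurable,
    (measurable_pi_apply 0).aemeasurable, ?_⟩⟩
  · refine iIndepSets.iIndep (fun i => (measurable_pi_apply i).comap_le) _
      isPiSystem_range_lowerPart comap_eval_eq_generateFrom ((iIndepSets_iff _ _).2 ?_)
    intro s f hf
    choose! q hq using hf
    -- The threshold 1 imposes no constraint on a point of `[0,1]`, so it pads the indices outside
    -- `s`.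
    set q' : ℕ → ℚ := fun i => if i ∈ s then q i else 1
    have hset : ⋂ i ∈ s, f i = cyl ((List.range (s.sup id + 1)).map q') := by
      ext x
      simp only [Set.mem_iInter, mem_cyl_iff, List.length_map, List.length_range,
        List.getElem_map, List.getElem_range]
      constructor
      · intro hx i _
        by_cases his : i ∈ s
        · have := hx i his
          rw [← hq i his] at this
          simpa [q', his] using this
        · simpa [q', his, lowerPart] using (x i).2.2
      · intro hx i hi
        have := hx i (Nat.lt_succ_of_le (Finset.le_sup (f := id) hi))
        rw [← hq i hi]
        simpa [q', hi] using this
    have hone : μ.real (cyl [1]) = 1 := by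
      have : cyl [1] = Set.univ := by
        rw [cyl_singleton]
        exact Set.eq_univ_of_forall fun x => by simpa [lowerPart] using (x 0).2.2
      rw [this, probReal_univ]
    have hreal : μ.real (⋂ i ∈ s, f i) = ∏ i ∈ s, μ.real (f i) := by
      rw [hset, hprod, List.map_map, ← Multiset.prod_coe, ← Multiset.map_coe]
      change ∏ i ∈ Finset.range (s.sup id + 1), μ.real (cyl [q' i]) = _
      rw [← Finset.prod_subset (s₁ := s)]
      · refine Finset.prod_congr rfl fun i hi => ?_
        rw [← hq i hi, hcoord]
        simp [q', hi]
      · intro i hi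
        exact Finset.mem_range.2 (Nat.lt_succ_of_le (Finset.le_sup (f := id) hi))
      · intro i _ hi
        simp [q', hi, hone]
    rw [← ENNReal.toReal_eq_toReal_iff' (measure_ne_top _ _)
      (ENNReal.prod_ne_top fun i _ => measure_ne_top _ _), ENNReal.toReal_prod]
    exact hreal
  · have hi : (fun x : Path => x i) = (fun x : Path => x 0) ∘ shift^[i] := by
      ext x
      simp [shift_iterate_apply]
    rw [hi, ← Measure.map_map (measurable_pi_apply 0) (measurable_shift.iterate i),
      (hμ.iterate i).map_eq]

/-- Only the term `m = 1`, `j = 1` is needed for the forward direction: independence of the first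
coordinate from the rest propagates by stationarity. Conversely, past and future use disjoint sets
of coordinates. -/
theorem alphaNorm_nonpos_iff_isIID {μ : Measure Path} (hμ : IsStationaryErgodic μ) :
    alphaNorm μ ≤ 0 ↔ IsIID μ := by
  have := hμ.1
  constructor
  · intro h
    refine isIID_of_measureReal_cyl_cons hμ.2.toMeasurePreserving
      (measureReal_cyl_cons_of_indep hμ.2.toMeasurePreserving fun U V hU hV => ?_)
    have h1 : alphaCoeff μ (0 + 1) = 0 := ENNReal.tsum_eq_zero.1 (nonpos_iff_eq_zero.1 h) 0
    simp only [alphaCoeff, alphaDep, ENNReal.iSup_eq_zero] at h1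
    have h2 := h1 1 le_rfl U hU V hV
    rw [ENNReal.ofReal_eq_zero] at h2
    exact sub_eq_zero.1 (abs_nonpos_iff.1 h2)
  · intro h
    simp only [nonpos_iff_eq_zero, alphaNorm, ENNReal.tsum_eq_zero, alphaCoeff, alphaDep,
      ENNReal.iSup_eq_zero]
    intro m j _ U hU V hV
    rw [past_eq] at hU
    rw [future_eq] at hV
    have hd : Disjoint (Set.Iio j) (Set.Ici (j + (m + 1) - 1)) := by
      rw [Set.disjoint_left]
      intro i hi hi'
      simp only [Set.mem_Iio, Set.mem_Ici] at hi hi'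
      omega
    have h1 := (Indep_iff _ _ _).1 (indep_coordSigma h hd) U V hU hV
    simp [Measure.real, h1, ENNReal.toReal_mul]

end IndepTest

/-! ### Empirical frequencies: almost sure limit and variance. -/

namespace IndepTest

/-- The indicator function of a cylinder. -/
noncomputable def cylInd (l : List ℚ) : Path → ℝ := (cyl l).indicator fun _ => 1

/-- The empirical frequency of a cylinder along the first `n` shifts of a path. -/
noncomputable def freq (l : List ℚ) (n : ℕ) (x : Path) : ℝ :=
  birkhoffAverage ℝ shift (cylInd l) n x

lemma cylInd_mem_Icc (l : List ℚ) (x : Path) : cylInd l x ∈ Set.Icc (0 : ℝ) 1 :=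
  ⟨Set.indicator_nonneg (fun _ _ => zero_le_one) x,
    Set.indicator_le_self' (f := fun _ => (1 : ℝ)) (fun _ _ => zero_le_one) x⟩

lemma measurable_cylInd (l : List ℚ) : Measurable (cylInd l) :=
  measurable_const.indicator (measurableSet_cyl l)

lemma measurable_cylInd_iterate {m : MeasurableSpace Path} {l : List ℚ} {k : ℕ}
    (h : MeasurableSet[m] (shift^[k] ⁻¹' cyl l)) :
    Measurable[m] fun x => cylInd l (shift^[k] x) := by
  have h1 : (fun x => cylInd l (shift^[k] x)) = (shift^[k] ⁻¹' cyl l).indicator fun _ => 1 := rfl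
  rw [h1]
  exact measurable_const.indicator h

lemma freq_eq (l : List ℚ) (n : ℕ) (x : Path) :
    freq l n x = (n : ℝ)⁻¹ * ∑ k ∈ Finset.range n, cylInd l (shift^[k] x) := rfl

lemma measurable_freq {m : MeasurableSpace Path} {l : List ℚ} {n : ℕ}
    (h : ∀ k < n, MeasurableSet[m] (shift^[k] ⁻¹' cyl l)) : Measurable[m] (freq l n) :=
  (Finset.measurable_fun_sum _ fun k hk =>
    measurable_cylInd_iterate (h k (Finset.mem_range.1 hk))).const_mul _

lemma measurable_past_freq {l : List ℚ} {n t : ℕ} (h : n + l.length ≤ t) :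
    Measurable[past t] (freq l n) := by
  refine measurable_freq fun k hk => ?_
  rw [past_eq]
  refine coordSigma_mono (fun i hi => ?_) _ (measurableSet_preimage_cyl l k)
  simp only [Set.mem_Ico, Set.mem_Iio] at hi ⊢
  omega

lemma freq_nonneg (l : List ℚ) (n : ℕ) (x : Path) : 0 ≤ freq l n x := by
  rw [freq_eq]
  exact mul_nonneg (by positivity) (Finset.sum_nonneg fun k _ => (cylInd_mem_Icc l _).1)

lemma freq_le_one (l : List ℚ) (n : ℕ) (x : Path) : freq l n x ≤ 1 := by
  rw [freq_eq]
  refine inv_mul_le_one_of_le₀ ?_ (by positivity)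
  calc ∑ k ∈ Finset.range n, cylInd l (shift^[k] x) ≤ ∑ _k ∈ Finset.range n, (1 : ℝ) :=
        Finset.sum_le_sum fun k _ => (cylInd_mem_Icc l _).2
    _ = n := by simp

lemma integral_cylInd (μ : Measure Path) (l : List ℚ) : ∫ x, cylInd l x ∂μ = μ.real (cyl l) :=
  integral_indicator_one (measurableSet_cyl l)

section

variable {μ : Measure Path} [IsProbabilityMeasure μ]

lemma integrable_cylInd (l : List ℚ) : Integrable (cylInd l) μ :=
  (integrable_const 1).indicator (measurableSet_cyl l)

lemma memLp_cylInd_iterate (l : List ℚ) (k : ℕ) :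
    MemLp (fun x => cylInd l (shift^[k] x)) 2 μ :=
  memLp_of_bounded (Eventually.of_forall fun _ => cylInd_mem_Icc l _)
    ((measurable_cylInd l).comp (measurable_shift.iterate k)).aestronglyMeasurable 2

lemma ae_tendsto_freq (hμ : Ergodic shift μ) (l : List ℚ) :
    ∀ᵐ x ∂μ, Tendsto (fun n => freq l n x) atTop (𝓝 (μ.real (cyl l))) := by
  rw [← integral_cylInd]
  exact ErgodicTheorem.ae_tendsto_birkhoffAverage hμ (measurable_cylInd l) (integrable_cylInd l)

lemma integral_freq (hμ : MeasurePreserving shift μ μ) (l : List ℚ) {n : ℕ} (hn : n ≠ 0) :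
    ∫ x, freq l n x ∂μ = μ.real (cyl l) := by
  have h : ∀ k, ∫ x, cylInd l (shift^[k] x) ∂μ = μ.real (cyl l) := fun k => by
    rw [← integral_map (φ := shift^[k]) (measurable_shift.iterate k).aemeasurable
      (measurable_cylInd l).aestronglyMeasurable, (hμ.iterate k).map_eq, integral_cylInd]
  simp_rw [freq_eq]
  rw [integral_const_mul, integral_finsetSum _ fun k _ =>
    (memLp_cylInd_iterate l k).integrable one_le_two]
  simp_rw [h]
  have : (n : ℝ) ≠ 0 := by exact_mod_cast hn
  simp [this]

lemma covariance_cylInd_le_one (l : List ℚ) (i j : ℕ) :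
    cov[fun x => cylInd l (shift^[i] x), fun x => cylInd l (shift^[j] x); μ] ≤ 1 := by
  have hi := memLp_cylInd_iterate (μ := μ) l i
  have hj := memLp_cylInd_iterate (μ := μ) l j
  rw [covariance_eq_sub hi hj]
  have h1 : ∫ x, ((fun x => cylInd l (shift^[i] x)) * fun x => cylInd l (shift^[j] x)) x ∂μ ≤ 1 := by
    calc _ ≤ ∫ _x, (1 : ℝ) ∂μ := integral_mono (hi.integrable_mul hj) (integrable_const _)
            fun _ => mul_le_one₀ (cylInd_mem_Icc l _).2 (cylInd_mem_Icc l _).1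
              (cylInd_mem_Icc l _).2
      _ = 1 := by simp
  have h2 : 0 ≤ ∫ x, cylInd l (shift^[i] x) ∂μ := integral_nonneg fun x => (cylInd_mem_Icc l _).1
  have h3 : 0 ≤ ∫ x, cylInd l (shift^[j] x) ∂μ := integral_nonneg fun x => (cylInd_mem_Icc l _).1
  linarith [mul_nonneg h2 h3]

lemma covariance_cylInd_eq_zero (h : IsIID μ) (l : List ℚ) {i j : ℕ}
    (hij : i + l.length ≤ j ∨ j + l.length ≤ i) :
    cov[fun x => cylInd l (shift^[i] x), fun x => cylInd l (shift^[j] x); μ] = 0 := by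
  refine IndepFun.covariance_eq_zero ?_ (memLp_cylInd_iterate l i) (memLp_cylInd_iterate l j)
  have hd : Disjoint (Set.Ico i (i + l.length)) (Set.Ico j (j + l.length)) := by
    rw [Set.disjoint_left]
    intro s hs hs'
    simp only [Set.mem_Ico] at hs hs'
    omega
  rw [IndepFun_iff_Indep]
  exact indep_of_indep_of_le_left (indep_of_indep_of_le_right (indep_coordSigma h hd)
    (measurable_cylInd_iterate (measurableSet_preimage_cyl l j)).comap_le)
    (measurable_cylInd_iterate (measurableSet_preimage_cyl l i)).comap_le

/-- Two occurrences whose blocks of coordinates are disjoint are uncorrelated. Each row of the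
covariance matrix thus has at most `2 * l.length` nonzero entries, each at most 1. -/
lemma variance_freq_le (h : IsIID μ) (l : List ℚ) (n : ℕ) :
    Var[freq l n; μ] ≤ 2 * l.length / n := by
  have hsum : Var[fun x => ∑ k ∈ Finset.range n, cylInd l (shift^[k] x); μ] ≤
      n * (2 * l.length) := by
    rw [variance_fun_sum' fun k _ => memLp_cylInd_iterate l k]
    calc _ ≤ ∑ _i ∈ Finset.range n, (2 * l.length : ℝ) := Finset.sum_le_sum fun i _ => ?_
      _ = n * (2 * l.length) := by simp
    calc _ ≤ ∑ j ∈ Finset.range n,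
            if j ∈ Finset.Ico (i + 1 - l.length) (i + l.length) then (1 : ℝ) else 0 :=
          Finset.sum_le_sum fun j _ => ?_
      _ ≤ 2 * l.length := ?_
    · split_ifs with hj
      · exact covariance_cylInd_le_one l i j
      · refine (covariance_cylInd_eq_zero h l ?_).le
        simp only [Finset.mem_Ico, not_and, not_lt] at hj
        omega
    · rw [Finset.sum_boole]
      have : (Finset.filter (· ∈ Finset.Ico (i + 1 - l.length) (i + l.length))
          (Finset.range n)).card ≤ 2 * l.length := by
        refine (Finset.card_le_card (t := Finset.Ico (i + 1 - l.length) (i + l.length))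
          fun j hj => (Finset.mem_filter.1 hj).2).trans ?_
        rw [Nat.card_Ico]
        omega
      exact_mod_cast this
  have hf : freq l n = fun x => (n : ℝ)⁻¹ * ∑ k ∈ Finset.range n, cylInd l (shift^[k] x) := rfl
  rw [hf, variance_const_mul]
  rcases Nat.eq_zero_or_pos n with rfl | hn
  · simp
  · have hn' : (0 : ℝ) < n := by exact_mod_cast hn
    calc _ ≤ ((n : ℝ)⁻¹) ^ 2 * (n * (2 * l.length)) := by gcongr
      _ = 2 * l.length / n := by field_simp

lemma measure_freq_deviation_le (hμ : MeasurePreserving shift μ μ) (h : IsIID μ) (l : List ℚ)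
    {n : ℕ} (hn : n ≠ 0) {δ : ℝ} (hδ : 0 < δ) :
    μ {x | δ ≤ |freq l n x - μ.real (cyl l)|} ≤
      ENNReal.ofReal (2 * l.length / n / δ ^ 2) := by
  have hL : MemLp (freq l n) 2 μ :=
    memLp_of_bounded (Eventually.of_forall fun x => ⟨freq_nonneg l n x, freq_le_one l n x⟩)
      (measurable_freq fun k _ =>
        measurable_shift.iterate k (measurableSet_cyl l)).aestronglyMeasurable 2
  rw [← integral_freq hμ l hn]
  refine (meas_ge_le_variance_div_sq hL hδ).trans (ENNReal.ofReal_le_ofReal ?_)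
  gcongr
  exact variance_freq_le h l n

end

/-! ### The test and its consistency. -/

/-- An enumeration of the pairs of a rational and a list of rationals. -/
def code (c : ℕ) : ℚ × List ℚ := Denumerable.ofNat (ℚ × List ℚ) c

/-- The empirical dependence between the first coordinate and the following ones. -/
noncomputable def discrepancy (c n : ℕ) (x : Path) : ℝ :=
  |freq ((code c).1 :: (code c).2) n x - freq [(code c).1] n x * freq (code c).2 n x|

/-- At stage `m`, independence is rejected if one of the first `m` coded pairs, of length at most
`m`, has an empirical dependence above `1 / (m + 1)` among the first `2 ^ m` shifts. -/
def Rejects (m : ℕ) (x : Path) : Prop :=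
  ∃ c < m, (code c).2.length < m ∧ 1 / ((m : ℝ) + 1) < discrepancy c (2 ^ m) x

/-- The stage of the test that is carried out at time `t`. -/
def stage (t : ℕ) : ℕ := Nat.log 2 t - 1

open Classical in
/-- The test for independence. -/
noncomputable def indepTest (t : ℕ) (x : Path) : ℤ := if Rejects (stage t) x then -1 else 1

lemma tendsto_stage : Tendsto stage atTop atTop := by
  refine tendsto_atTop.2 fun m => ?_
  filter_upwards [eventually_ge_atTop (2 ^ (m + 1))] with t ht
  have := Nat.le_log_of_pow_le one_lt_two ht
  unfold stage
  omega

/-- Stage `m` looks at blocks of length at most `m` under `2 ^ m` shifts, so `2 ^ m + m`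
observations suffice. The `- 1` in `stage` provides them, as `m ≤ 2 ^ m`. -/
lemma two_pow_stage_add_le {t : ℕ} (h : stage t ≠ 0) : 2 ^ stage t + stage t ≤ t := by
  have ht : t ≠ 0 := by
    rintro rfl
    simp [stage] at h
  have h1 : 2 ^ (stage t + 1) ≤ t := by
    have h2 : stage t + 1 = Nat.log 2 t := by
      unfold stage at h ⊢
      omega
    rw [h2]
    exact Nat.pow_log_le_self 2 ht
  have := (Nat.lt_two_pow_self (n := stage t)).le
  rw [pow_succ] at h1
  omega

lemma measurableSet_rejects (t : ℕ) : MeasurableSet[past t] {x | Rejects (stage t) x} := by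
  have h : {x | Rejects (stage t) x} = ⋃ c, ⋃ (_ : c < stage t),
      ⋃ (_ : (code c).2.length < stage t),
        {x | 1 / ((stage t : ℝ) + 1) < discrepancy c (2 ^ stage t) x} := by
    ext x
    simp only [Rejects, Set.mem_ofPred_eq, Set.mem_iUnion, exists_prop]
  rw [h]
  refine .iUnion fun c => .iUnion fun hc => .iUnion fun hl => ?_
  have hs := two_pow_stage_add_le (t := t) (by omega)
  have h1 : Measurable[past t] (freq ((code c).1 :: (code c).2) (2 ^ stage t)) :=
    measurable_past_freq (by rw [List.length_cons]; omega)
  have h2 : Measurable[past t] (freq [(code c).1] (2 ^ stage t)) :=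
    measurable_past_freq (by rw [List.length_singleton]; omega)
  have h3 : Measurable[past t] (freq (code c).2 (2 ^ stage t)) :=
    measurable_past_freq (by omega)
  have h4 : Measurable[past t] (discrepancy c (2 ^ stage t)) :=
    measurable_norm.comp (h1.sub (h2.mul h3))
  exact h4 measurableSet_Ioi

lemma isSequentialTest_indepTest : IsSequentialTest indepTest := by
  refine fun t => ⟨?_, fun x => ?_⟩
  · exact Measurable.ite (measurableSet_rejects t) measurable_const measurable_const
  · unfold indepTest
    split_ifs <;> simp

lemma discrepancy_lt {c n : ℕ} {x : Path} {μ : Measure Path} [IsProbabilityMeasure μ] {δ : ℝ}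
    (hcyl : ∀ q l, μ.real (cyl (q :: l)) = μ.real (cyl [q]) * μ.real (cyl l))
    (h1 : |freq ((code c).1 :: (code c).2) n x - μ.real (cyl ((code c).1 :: (code c).2))| < δ)
    (h2 : |freq [(code c).1] n x - μ.real (cyl [(code c).1])| < δ)
    (h3 : |freq (code c).2 n x - μ.real (cyl (code c).2)| < δ) :
    discrepancy c n x < 3 * δ := by
  unfold discrepancy
  rw [hcyl] at h1
  set a := freq ((code c).1 :: (code c).2) n x
  have hb0 := freq_nonneg [(code c).1] n x
  have hb1 := freq_le_one [(code c).1] n x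
  set b := freq [(code c).1] n x
  set d := freq (code c).2 n x
  have hD0 : 0 ≤ μ.real (cyl (code c).2) := measureReal_nonneg
  have hD1 : μ.real (cyl (code c).2) ≤ 1 := measureReal_le_one
  set D := μ.real (cyl (code c).2)
  set B := μ.real (cyl [(code c).1])
  have e : a - b * d = (a - B * D) - (b - B) * D - b * (d - D) := by ring
  have h4 : |(b - B) * D| ≤ |b - B| := by
    rw [abs_mul, abs_of_nonneg hD0]
    exact mul_le_of_le_one_right (abs_nonneg _) hD1
  have h5 : |b * (d - D)| ≤ |d - D| := by
    rw [abs_mul, abs_of_nonneg hb0]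
    exact mul_le_of_le_one_left (abs_nonneg _) hb1
  rw [e]
  linarith [abs_sub ((a - B * D) - (b - B) * D) (b * (d - D)), abs_sub (a - B * D) ((b - B) * D)]

/-- A false rejection forces one of three frequencies, for one of `m` codes, to deviate by `δ`;
Chebyshev's inequality bounds each such event. -/
lemma measure_rejects_le {μ : Measure Path} [IsProbabilityMeasure μ]
    (hμ : MeasurePreserving shift μ μ) (h : IsIID μ) (m : ℕ) :
    μ {x | Rejects m x} ≤ ENNReal.ofReal (54 * (((m + 1 : ℕ) : ℝ) ^ 4 * (1 / 2) ^ m)) := by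
  have hcyl : ∀ q l, μ.real (cyl (q :: l)) = μ.real (cyl [q]) * μ.real (cyl l) := by
    refine measureReal_cyl_cons_of_indep hμ fun U V hU hV => ?_
    rw [past_eq] at hU
    rw [future_eq] at hV
    have hd : Disjoint (Set.Iio 1) (Set.Ici 1) := Set.Iio_disjoint_Ici le_rfl
    have h1 := (Indep_iff _ _ _).1 (indep_coordSigma h hd) U V hU hV
    simp [Measure.real, h1, ENNReal.toReal_mul]
  -- Three deviations below `δ` add up to less than the rejection threshold `1 / (m + 1)`.
  set δ : ℝ := 1 / (3 * ((m : ℝ) + 1)) with hδ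
  have hδ0 : 0 < δ := by positivity
  set D : List ℚ → Set Path := fun l => {x | δ ≤ |freq l (2 ^ m) x - μ.real (cyl l)|} with hD
  -- This is Chebyshev's bound `2 (m + 1) / 2 ^ m / δ ^ 2`, where `1 / δ ^ 2 = 9 (m + 1) ^ 2`.
  set r : ℝ := 18 * (((m + 1 : ℕ) : ℝ) ^ 3 * (1 / 2) ^ m) with hr
  have hr0 : 0 ≤ r := by positivity
  have hdev : ∀ l : List ℚ, l.length ≤ m → μ (D l) ≤ ENNReal.ofReal r := by
    intro l hl
    refine (measure_freq_deviation_le hμ h l (by positivity) hδ0).trans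
      (ENNReal.ofReal_le_ofReal ?_)
    have hl' : (l.length : ℝ) ≤ (m : ℝ) + 1 := by
      have : (l.length : ℝ) ≤ m := by exact_mod_cast hl
      linarith
    calc _ ≤ 2 * ((m : ℝ) + 1) / ((2 ^ m : ℕ) : ℝ) / δ ^ 2 := by gcongr
      _ = r := by
        rw [hδ, hr, one_div_pow (2 : ℝ) m]
        have hp : (2 : ℝ) ^ m ≠ 0 := by positivity
        push_cast
        generalize (2 : ℝ) ^ m = p at hp
        field_simp
        ring
  have hsub : {x | Rejects m x} ⊆ ⋃ c ∈ Finset.range m, {x | (code c).2.length < m ∧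
      x ∈ D ((code c).1 :: (code c).2) ∪ D [(code c).1] ∪ D (code c).2} := by
    rintro x ⟨c, hc, hl, hx⟩
    simp only [Set.mem_iUnion]
    refine ⟨c, Finset.mem_range.2 hc, hl, ?_⟩
    by_contra hcon
    simp only [hD, Set.mem_union, Set.mem_ofPred_eq, not_or, not_le] at hcon
    have := discrepancy_lt hcyl hcon.1.1 hcon.1.2 hcon.2
    have e : 3 * δ = 1 / ((m : ℝ) + 1) := by
      rw [hδ]
      field_simp
    linarith
  have hterm : ∀ c ∈ Finset.range m, μ {x | (code c).2.length < m ∧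
      x ∈ D ((code c).1 :: (code c).2) ∪ D [(code c).1] ∪ D (code c).2} ≤
        ENNReal.ofReal (3 * r) := by
    intro c _
    by_cases hl : (code c).2.length < m
    · calc _ ≤ μ (D ((code c).1 :: (code c).2) ∪ D [(code c).1] ∪ D (code c).2) :=
            measure_mono fun _ hx => hx.2
        _ ≤ ENNReal.ofReal r + ENNReal.ofReal r + ENNReal.ofReal r :=
            (measure_union_le _ _).trans (add_le_add ((measure_union_le _ _).trans
              (add_le_add (hdev _ (by rw [List.length_cons]; omega))
                (hdev _ (by rw [List.length_singleton]; omega)))) (hdev _ hl.le))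
        _ = ENNReal.ofReal (3 * r) := by
            rw [← ENNReal.ofReal_add hr0 hr0, ← ENNReal.ofReal_add (by positivity) hr0]
            congr 1
            ring
    · simp [hl]
  calc _ ≤ ∑ c ∈ Finset.range m, μ {x | (code c).2.length < m ∧
          x ∈ D ((code c).1 :: (code c).2) ∪ D [(code c).1] ∪ D (code c).2} :=
        (measure_mono hsub).trans (measure_biUnion_finset_le _ _)
    _ ≤ ∑ _c ∈ Finset.range m, ENNReal.ofReal (3 * r) := Finset.sum_le_sum hterm
    _ = ENNReal.ofReal (m * (3 * r)) := by
        rw [Finset.sum_const, Finset.card_range, nsmul_eq_mul,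
          ENNReal.ofReal_mul (Nat.cast_nonneg m), ENNReal.ofReal_natCast]
    _ ≤ _ := by
        refine ENNReal.ofReal_le_ofReal ?_
        calc (m : ℝ) * (3 * r) ≤ ((m + 1 : ℕ) : ℝ) * (3 * r) := by
              gcongr
              omega
          _ = _ := by
              rw [hr]
              ring

lemma ae_eventually_not_rejects {μ : Measure Path} [IsProbabilityMeasure μ]
    (hμ : MeasurePreserving shift μ μ) (h : IsIID μ) :
    ∀ᵐ x ∂μ, ∀ᶠ m in atTop, ¬ Rejects m x := by
  refine ae_eventually_notMem (s := fun m => {x | Rejects m x}) ?_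
  have hsum : Summable fun m : ℕ => 54 * (((m + 1 : ℕ) : ℝ) ^ 4 * (1 / 2) ^ m) := by
    have h1 := (summable_nat_add_iff 1).2
      (summable_pow_mul_geometric_of_norm_lt_one (R := ℝ) 4 (r := 1 / 2) (by norm_num))
    -- The constant is `2 * 54`: the shifted series carries `(1 / 2) ^ (m + 1)`.
    refine (h1.mul_left 108).congr fun m => ?_
    rw [pow_succ (1 / 2 : ℝ) m]
    ring
  refine ne_top_of_le_ne_top ?_ (ENNReal.tsum_le_tsum (measure_rejects_le hμ h))
  exact hsum.tsum_ofReal_ne_top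

/-- A single violated identity suffices: its code is fixed, so it is examined at all late stages,
and its discrepancy stays away from 0 while the threshold vanishes. -/
lemma ae_eventually_rejects {μ : Measure Path} (hμ : IsStationaryErgodic μ) (h : ¬ IsIID μ) :
    ∀ᵐ x ∂μ, ∀ᶠ m in atTop, Rejects m x := by
  have := hμ.1
  obtain ⟨q, l, hne⟩ : ∃ q l, μ.real (cyl (q :: l)) ≠ μ.real (cyl [q]) * μ.real (cyl l) := by
    by_contra! hcon
    exact h (isIID_of_measureReal_cyl_cons hμ.2.toMeasurePreserving hcon)
  obtain ⟨c, hcode⟩ : ∃ c, code c = (q, l) := ⟨_, Denumerable.ofNat_encode _⟩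
  filter_upwards [ae_tendsto_freq hμ.2 (q :: l), ae_tendsto_freq hμ.2 [q],
    ae_tendsto_freq hμ.2 l] with x h1 h2 h3
  have hlim : Tendsto (fun m : ℕ => discrepancy c (2 ^ m) x) atTop
      (𝓝 |μ.real (cyl (q :: l)) - μ.real (cyl [q]) * μ.real (cyl l)|) := by
    simp only [discrepancy, hcode]
    exact ((h1.sub (h2.mul h3)).abs).comp (tendsto_pow_atTop_atTop_of_one_lt one_lt_two)
  have hev := tendsto_one_div_add_atTop_nhds_zero_nat.eventually_lt hlim
    (abs_pos.2 (sub_ne_zero.2 hne))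
  filter_upwards [hev, eventually_gt_atTop c, eventually_gt_atTop l.length] with m hm hcm hlm
  exact ⟨c, hcm, by rwa [hcode], hm⟩

theorem isStronglyConsistent_indepTest : IsStronglyConsistent indepTest IsIID := by
  intro μ hμ
  have := hμ.1
  refine ⟨fun h => ?_, fun h => ?_⟩
  · filter_upwards [ae_eventually_not_rejects hμ.2.toMeasurePreserving h] with x hx
    refine tendsto_const_nhds.congr' ?_
    filter_upwards [tendsto_stage.eventually hx] with t ht
    rw [indepTest, if_neg ht]
  · filter_upwards [ae_eventually_rejects hμ h] with x hx
    refine tendsto_const_nhds.congr' ?_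
    filter_upwards [tendsto_stage.eventually hx] with t ht
    rw [indepTest, if_pos ht]

end IndepTest

theorem mainTheorem11 :
    ∃ f : ℕ → IndepTest.Path → ℤ,
      IndepTest.IsSequentialTest f ∧
      IndepTest.IsStronglyConsistent f IndepTest.IsIID ∧
      IndepTest.IsStronglyConsistent f (fun μ => IndepTest.alphaNorm μ ≤ 0) := by
  refine ⟨IndepTest.indepTest, IndepTest.isSequentialTest_indepTest,
    IndepTest.isStronglyConsistent_indepTest, fun μ hμ => ?_⟩
  simp only [IndepTest.alphaNorm_nonpos_iff_isIID hμ]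
  exact IndepTest.isStronglyConsistent_indepTest μ hμ
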